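/- Let $n\ge 0$ be an integer. A unit vector $\psi\in(\mathbb C^2)^{\otimes n}$ is a *stabilizer vector* if there is a subgroup $S$ of the $n$-qubit Pauli group (tensor products of single-qubit Pauli operators, with phases in $\{\pm1,\pm i\}$) of order $2^n$ such that $P\psi=\psi$ for all $P\in S$; let $\mathrm{Stab}_n$ be the set of the pure states $|\psi\rangle\langle\psi|$ of stabilizer vectors $\psi$. For integers $s,m\ge 0$ and real $\epsilon$, a set $\mathcal S$ of $n$-qubit states *admits an $(s,s+m,\epsilon)$-quantum cloning scheme* if there is a completely positive trace-preserving linear map $\Lambda$ from operators on $((\mathbb C^2)^{\otimes n})^{\otimes s}$ to operators on $((\mathbb C^2)^{\otimes n})^{\otimes (s+m)}$ with $\tfrac12\|\Lambda(\rho^{\otimes s})-\rho^{\otimes (s+m)}\|_1\le\epsilon$ for every $\rho\in\mathcal S$. **Theorem.** Let $\epsilon\le 0.14$. Then $\mathrm{Stab}_n$ does not admit a $(t-1,t,\epsilon)$-quantum cloning scheme for any integer $t$ with $1\le t\le\lfloor n/4\rfloor$. Consequently, if $\mathrm{Stab}_n$ admits an $(s,s+m,\epsilon)$-quantum cloning scheme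 for some $s\ge0$ and $m\ge 1$, then $s\ge\lfloor n/4\rfloor$; that is, cloning $n$-qubit stabilizer states needs $\Omega(n)$ copies. -/

import Mathlib

/-! ## Qubits, density matrices and tensor powers -/

/-- Labels of the computational basis `|x⟩`, `x ∈ {0,1}ⁿ`, of `n` qubits. -/
abbrev Qubits (n : ℕ) : Type := Fin n → ZMod 2

/-- Linear operators on the `n`-qubit space `ℂ^(2ⁿ)`, as matrices in the computational basis. -/
abbrev QOp (n : ℕ) : Type := Matrix (Qubits n) (Qubits n) ℂ

/-- Linear operators on `t` copies `(ℂ^(2ⁿ))^{⊗ t}` of the `n`-qubit space; the basis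
`|x₁⟩ ⊗ ⋯ ⊗ |x_t⟩` is labelled by the tuple `(x₁, …, x_t)`. For `t = 0` this is `ℂ`. -/
abbrev QOpPow (n t : ℕ) : Type := Matrix (Fin t → Qubits n) (Fin t → Qubits n) ℂ

/-- The tensor product `A₁ ⊗ ⋯ ⊗ A_k` of matrices, in the product basis. -/
def tensorProd {k : ℕ} {ι : Type*} (A : Fin k → Matrix ι ι ℂ) :
    Matrix (Fin k → ι) (Fin k → ι) ℂ :=
  Matrix.of fun x y => ∏ i, A i (x i) (y i)

/-- The state `ρ^{⊗ t}` of `t` independent copies of an `n`-qubit state `ρ`. -/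
def copies {n : ℕ} (t : ℕ) (ρ : QOp n) : QOpPow n t :=
  tensorProd fun _ : Fin t => ρ

/-- The projector `|ψ⟩⟨ψ|`. -/
def ketBra {n : ℕ} (ψ : Qubits n → ℂ) : QOp n :=
  Matrix.vecMulVec ψ (star ψ)

/-! ## Pauli operators and stabilizer states -/

/-- The single-qubit operator `X`, `X|a⟩ = |a ⊕ 1⟩`. -/
def pauliX : Matrix (ZMod 2) (ZMod 2) ℂ :=
  Matrix.of fun a b => if a = b + 1 then 1 else 0

/-- The single-qubit operator `Z`, `Z|a⟩ = (-1)^a |a⟩`. -/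
def pauliZ : Matrix (ZMod 2) (ZMod 2) ℂ :=
  Matrix.diagonal fun a => (-1) ^ a.val

/-- The phaseless Pauli operator `⨂ᵢ Z^{aᵢ} X^{bᵢ}` on `n` qubits. -/
def weyl {n : ℕ} (a b : Fin n → ZMod 2) : QOp n :=
  tensorProd fun i => pauliZ ^ (a i).val * pauliX ^ (b i).val

/-- Membership in the `n`-qubit Pauli group: tensor products of products of `X` and `Z`,
with a phase in `{1, i, -1, -i}`. -/
def IsPauli {n : ℕ} (P : QOp n) : Prop :=
  ∃ (k : ℕ) (a b : Fin n → ZMod 2), P = Complex.I ^ k • weyl a b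

/-- The unit vector `ψ` is a stabilizer state: some subgroup of the Pauli group of order `2ⁿ`
fixes `ψ`. -/
def IsStabilizerVector {n : ℕ} (ψ : Qubits n → ℂ) : Prop :=
  ∑ x, ‖ψ x‖ ^ 2 = 1 ∧
    ∃ S : Subgroup (QOp n)ˣ,
      (∀ P ∈ S, IsPauli (P : QOp n)) ∧ Nat.card S = 2 ^ n ∧
        ∀ P ∈ S, (P : QOp n).mulVec ψ = ψ

/-- `Stabₙ`: the (density matrices of) pure `n`-qubit stabilizer states. -/
def Stab (n : ℕ) : Set (QOp n) :=
  {ρ | ∃ ψ : Qubits n → ℂ, IsStabilizerVector ψ ∧ ρ = ketBra ψ}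

/-! ## Trace distance and cloning schemes -/

open scoped MatrixOrder Matrix.Norms.L2Operator in
/-- The trace norm `‖A‖₁ = tr |A|`, where `|A| = √(A* A)`. -/
noncomputable def traceNorm {ι : Type*} [Fintype ι] [DecidableEq ι] (A : Matrix ι ι ℂ) : ℝ :=
  (CFC.abs A).trace.re

/-- The trace distance `½ ‖ρ - σ‖₁`. -/
noncomputable def traceDist {ι : Type*} [Fintype ι] [DecidableEq ι] (ρ σ : Matrix ι ι ℂ) : ℝ :=
  traceNorm (ρ - σ) / 2

open scoped MatrixOrder Matrix.Norms.L2Operator CStarAlgebra in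
/-- A class `𝒮` of `n`-qubit states admits an `(s, t, ε)`-quantum cloning scheme: some completely
positive trace-preserving map `Λ` from operators on `s` copies to operators on `t` copies takes
`ρ^{⊗ s}` to within trace distance `ε` of `ρ^{⊗ t}`, for every `ρ ∈ 𝒮`. Here positivity of a matrix
is positive semidefiniteness. -/
def AdmitsCloning {n : ℕ} (𝒮 : Set (QOp n)) (s t : ℕ) (ε : ℝ) : Prop :=
  ∃ Λ : QOpPow n s →CP QOpPow n t,
    (∀ M : QOpPow n s, (Λ M).trace = M.trace) ∧
      ∀ ρ ∈ 𝒮, traceDist (Λ (copies s ρ)) (copies t ρ) ≤ ε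

/-!
Cloning already fails on the quadratic phase states
`ψ_A = 2^(-n/2) ∑ₓ (-1)^(xᵀ A x) |x⟩`, with `A` an `n × n` matrix over `𝔽₂`. Each is a stabilizer
state: conjugating the shifts `X^b` by the diagonal of `ψ_A` gives `2^n` commuting Pauli operators
that fix it (`isStabilizerVector_phaseState`).

The sign of `ψ_A^{⊗ t}` at a tuple `x = (x₁, …, x_t)` is the character `χ_A` of the group of
matrices over `𝔽₂`, evaluated at the Gram matrix `∑ᵢ xᵢ xᵢᵀ`. Hence averages over `A` are governed
by the fibres of `tupleGram`. On linearly independent `t`-tuples each nonempty fibre has exactly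
`|O(t)|` elements, where `O(t)` is the orthogonal group over `𝔽₂` (`card_gram_fiber`), and
`|O(t)| ≤ 2^t |O(t - 1)|` (`orthogonalCard_succ_le`). Dependent tuples are rare
(`card_not_linearIndependent_le`).

Let `Λ` be positive and trace preserving, from `s` copies to `s + 1 + m`, and let `g_A` be the part
of `ψ_A^{⊗ (s + 1 + m)}` on the tuples whose first `s + 1` strings are independent. If `Λ` clones
well, then `⟨g_A| Λ(ψ_A^{⊗ s}) |g_A⟩` is close to `1` for every `A`
(`neg_traceNorm_le_expectation`). On the other hand, up to dependent tuples and a factor `2`, all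
the `ψ_A^{⊗ s}` are dominated by a single operator of trace at most `D`, the number of Gram
matrices of independent `s`-tuples, while the average over `A` of `|g_A⟩⟨g_A|` is at most
`N / 2^(n (s + 1 + m))` for the largest fibre size `N`. The average of the expectation is therefore
at most about `2 D N / 2^(n (s + 1 + m)) ≤ 2 · 2^(s + 1) / 2^n` (`sum_expectation_map_le`), which is
small for `4 (s + 1) ≤ n`.
-/

open Matrix
open scoped ComplexOrder

/-! ### Expectations in real vectors -/

section Expectation

variable {ι : Type*} [Fintype ι]

/-- The real part of `⟨g|B|g⟩`, for a vector `g` with real coordinates. -/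
noncomputable def expectation (g : ι → ℝ) (B : Matrix ι ι ℂ) : ℝ :=
  ∑ x, ∑ y, g x * g y * (B x y).re

lemma expectation_add (g : ι → ℝ) (A B : Matrix ι ι ℂ) :
    expectation g (A + B) = expectation g A + expectation g B := by
  simp [expectation, mul_add, Finset.sum_add_distrib]

lemma expectation_sub (g : ι → ℝ) (A B : Matrix ι ι ℂ) :
    expectation g (A - B) = expectation g A - expectation g B := by
  simp [expectation, mul_sub, Finset.sum_sub_distrib]

lemma expectation_smul (g : ι → ℝ) (c : ℝ) (B : Matrix ι ι ℂ) :
    expectation g ((c : ℂ) • B) = c * expectation g B := by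
  simp only [expectation, Finset.mul_sum, Matrix.smul_apply, smul_eq_mul, Complex.re_ofReal_mul]
  exact Finset.sum_congr rfl fun x _ => Finset.sum_congr rfl fun y _ => by ring

lemma expectation_smul_vec (c : ℝ) (g : ι → ℝ) (B : Matrix ι ι ℂ) :
    expectation (c • g) B = c ^ 2 * expectation g B := by
  simp only [expectation, Finset.mul_sum, Pi.smul_apply, smul_eq_mul]
  exact Finset.sum_congr rfl fun x _ => Finset.sum_congr rfl fun y _ => by ring

/-- `|g⟩⟨g|` for a vector `g` with real coordinates. -/
noncomputable def realKetBra (g : ι → ℝ) : Matrix ι ι ℂ :=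
  vecMulVec (fun x => (g x : ℂ)) (star fun x => (g x : ℂ))

lemma realKetBra_apply {ι : Type*} (g : ι → ℝ) (x y : ι) : realKetBra g x y = (g x * g y : ℝ) := by
  simp [realKetBra, vecMulVec_apply]

lemma posSemidef_realKetBra (g : ι → ℝ) : (realKetBra g).PosSemidef :=
  posSemidef_vecMulVec_self_star _

lemma trace_realKetBra (g : ι → ℝ) : (realKetBra g).trace = (∑ x, g x ^ 2 : ℝ) := by
  simp [trace, realKetBra_apply, sq]

lemma expectation_realKetBra (g φ : ι → ℝ) :
    expectation g (realKetBra φ) = (∑ x, g x * φ x) ^ 2 := by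
  simp only [expectation, realKetBra_apply, Complex.ofReal_re, sq, Finset.sum_mul_sum]
  exact Finset.sum_congr rfl fun x _ => Finset.sum_congr rfl fun y _ => by ring

lemma expectation_nonneg (g : ι → ℝ) {B : Matrix ι ι ℂ} (hB : B.PosSemidef) :
    0 ≤ expectation g B := by
  have h := (Complex.le_def.1 (hB.dotProduct_mulVec_nonneg fun x => (g x : ℂ))).1
  refine h.trans_eq ?_
  simp only [dotProduct, mulVec, expectation, Finset.mul_sum, Complex.re_sum]
  refine Finset.sum_congr rfl fun x _ => Finset.sum_congr rfl fun y _ => ?_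
  simp
  ring

lemma two_mul_re_le_of_posSemidef {ι : Type*} {B : Matrix ι ι ℂ} (hB : B.PosSemidef)
    (x y : ι) (a b : ℝ) :
    2 * (a * b) * (B x y).re ≤ a ^ 2 * (B x x).re + b ^ 2 * (B y y).re := by
  have h := expectation_nonneg ![a, -b] (hB.submatrix ![x, y])
  have hxy : (B y x).re = (B x y).re := by
    rw [← hB.isHermitian.apply y x]
    simp
  simp [expectation, Fin.sum_univ_two, hxy] at h
  linarith

lemma re_trace (B : Matrix ι ι ℂ) : B.trace.re = ∑ x, (B x x).re := by
  simp [trace]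

lemma expectation_le_trace {g : ι → ℝ} (hg : ∑ x, g x ^ 2 ≤ 1) {B : Matrix ι ι ℂ}
    (hB : B.PosSemidef) : expectation g B ≤ B.trace.re := by
  have h0 : 0 ≤ B.trace.re := (Complex.le_def.1 hB.trace_nonneg).1
  have h : 2 * expectation g B ≤ 2 * ((∑ x, g x ^ 2) * B.trace.re) := by
    calc 2 * expectation g B
        = ∑ x, ∑ y, 2 * (g y * g x) * (B x y).re := by
          simp only [expectation, Finset.mul_sum]
          exact Finset.sum_congr rfl fun x _ => Finset.sum_congr rfl fun y _ => by ring
      _ ≤ ∑ x, ∑ y, (g y ^ 2 * (B x x).re + g x ^ 2 * (B y y).re) :=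
          Finset.sum_le_sum fun x _ => Finset.sum_le_sum fun y _ =>
            two_mul_re_le_of_posSemidef hB x y _ _
      _ = 2 * ((∑ x, g x ^ 2) * B.trace.re) := by
          simp only [Finset.sum_add_distrib, ← Finset.sum_mul, ← Finset.mul_sum, re_trace]
          ring
  nlinarith

open scoped MatrixOrder Matrix.Norms.L2Operator in
/-- A vector of norm at most `1` sees a Hermitian `Δ` with expectation at least `-‖Δ‖₁`, because
`|Δ| + Δ` is positive. -/
lemma neg_traceNorm_le_expectation [DecidableEq ι] {g : ι → ℝ} (hg : ∑ x, g x ^ 2 ≤ 1)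
    {Δ : Matrix ι ι ℂ} (hΔ : Δ.IsHermitian) : -traceNorm Δ ≤ expectation g Δ := by
  have h1 : (CFC.abs Δ + Δ).PosSemidef := by
    rw [CFC.abs_add_self Δ hΔ]
    exact (nsmul_nonneg (CFC.posPart_nonneg Δ) 2).posSemidef
  have h2 := expectation_nonneg g h1
  rw [expectation_add] at h2
  have h3 := expectation_le_trace hg (CFC.abs_nonneg Δ).posSemidef
  unfold traceNorm
  linarith

/-- Cauchy–Schwarz for rank-one operators: `|∑ uᵢ⟩⟨∑ uᵢ| ≤ #S · ∑ |uᵢ⟩⟨uᵢ|`. -/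
lemma posSemidef_card_smul_sum_sub {κ : Type*} (S : Finset κ) (u : κ → ι → ℝ) :
    (((S.card : ℝ) : ℂ) • ∑ i ∈ S, realKetBra (u i) - realKetBra (∑ i ∈ S, u i)).PosSemidef := by
  -- Lagrange's identity writes twice the difference as a sum of rank-one projectors.
  have key : ((S.card : ℝ) : ℂ) • ∑ i ∈ S, realKetBra (u i) - realKetBra (∑ i ∈ S, u i)
      = (1 / 2 : ℂ) • ∑ i ∈ S, ∑ j ∈ S, realKetBra (u i - u j) := by
    ext x y
    have h : (S.card : ℝ) * ∑ i ∈ S, u i x * u i y - (∑ i ∈ S, u i x) * (∑ i ∈ S, u i y)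
        = 1 / 2 * ∑ i ∈ S, ∑ j ∈ S, (u i x - u j x) * (u i y - u j y) := by
      simp only [sub_mul, mul_sub, Finset.sum_sub_distrib, Finset.sum_const, nsmul_eq_mul,
        ← Finset.mul_sum, ← Finset.sum_mul]
      ring
    simpa [Matrix.sum_apply, realKetBra_apply] using congrArg (fun r : ℝ => (r : ℂ)) h
  rw [key]
  refine PosSemidef.smul (posSemidef_sum _ fun i _ => posSemidef_sum _ fun j _ =>
    posSemidef_realKetBra _) ?_
  rw [show (1 / 2 : ℂ) = ((1 / 2 : ℝ) : ℂ) by norm_num]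
  exact_mod_cast (by norm_num : (0 : ℝ) ≤ 1 / 2)

end Expectation

/-! ### Gram matrices of independent tuples over `𝔽₂` -/

/-- The Gram matrix `∑ᵢ xᵢ xᵢᵀ` over `𝔽₂` of a tuple of bit strings. -/
def tupleGram {k n : ℕ} (x : Fin k → Qubits n) : Matrix (Fin n) (Fin n) (ZMod 2) :=
  ∑ i, vecMulVec (x i) (x i)

lemma tupleGram_eq {k n : ℕ} (x : Fin k → Qubits n) : tupleGram x = (of x)ᵀ * of x := by
  ext i j
  simp [tupleGram, Matrix.sum_apply, Matrix.mul_apply, vecMulVec_apply]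

/-- The number of `k × k` matrices `M` over `𝔽₂` with `Mᵀ M = 1`. -/
def orthogonalCard (k : ℕ) : ℕ :=
  (Finset.univ.filter fun M : Matrix (Fin k) (Fin k) (ZMod 2) => Mᵀ * M = 1).card

lemma exists_mul_eq_one_of_linearIndependent {k n : ℕ} {x : Fin k → Qubits n}
    (hx : LinearIndependent (ZMod 2) x) :
    ∃ R : Matrix (Fin n) (Fin k) (ZMod 2), of x * R = 1 := by
  have hinj : Function.Injective (of x).vecMul := Matrix.vecMul_injective_iff.2 hx
  obtain ⟨g, hg⟩ := LinearMap.exists_leftInverse_of_injective (of x).vecMulLinear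
    (LinearMap.ker_eq_bot.2 hinj)
  refine ⟨LinearMap.toMatrixRight' g, ?_⟩
  have h := congrArg LinearMap.toMatrixRight' hg
  rw [LinearMap.toMatrixRight'_id] at h
  rw [← h]
  apply Matrix.toLinearMapRight'.injective
  ext i j
  simp [Matrix.toLinearMapRight'_mul]

lemma linearIndependent_of_mul_eq_one {k n : ℕ} {x : Fin k → Qubits n}
    {R : Matrix (Fin n) (Fin k) (ZMod 2)} (h : of x * R = 1) : LinearIndependent (ZMod 2) x := by
  refine Matrix.vecMul_injective_iff.1 (?_ : Function.Injective (of x).vecMul)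
  refine Function.LeftInverse.injective (g := R.vecMul) fun v => ?_
  change v ᵥ* of x ᵥ* R = v
  rw [vecMul_vecMul, h, vecMul_one]

open Classical in
/-- The linearly independent tuples with a given Gram matrix are a torsor under the orthogonal
group: they are the `M x₀` with `Mᵀ M = 1`, where `x₀` is one of them. -/
lemma card_gram_fiber {k n : ℕ} {x₀ : Fin k → Qubits n} (h₀ : LinearIndependent (ZMod 2) x₀) :
    (Finset.univ.filter fun x : Fin k → Qubits n =>
      LinearIndependent (ZMod 2) x ∧ tupleGram x = tupleGram x₀).card = orthogonalCard k := by
  obtain ⟨R₀, hR₀⟩ := exists_mul_eq_one_of_linearIndependent h₀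
  symm
  refine Finset.card_bij (fun M _ => M * of x₀) ?_ ?_ ?_
  · intro M hM
    replace hM := (Finset.mem_filter.1 hM).2
    refine Finset.mem_filter.2 ⟨Finset.mem_univ _, ?_, ?_⟩
    · refine linearIndependent_of_mul_eq_one (R := R₀ * Mᵀ) ?_
      calc M * of x₀ * (R₀ * Mᵀ) = M * (of x₀ * R₀) * Mᵀ := by simp only [Matrix.mul_assoc]
        _ = 1 := by rw [hR₀, Matrix.mul_one, mul_eq_one_comm.1 hM]
    · refine (tupleGram_eq _).trans (Eq.trans ?_ (tupleGram_eq x₀).symm)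
      calc (M * of x₀)ᵀ * (M * of x₀) = (of x₀)ᵀ * (Mᵀ * M) * of x₀ := by
            simp only [Matrix.transpose_mul, Matrix.mul_assoc]
        _ = _ := by rw [hM, Matrix.mul_one]
  · intro M _ N _ h
    have h' := congrArg (fun Y : Matrix (Fin k) (Fin n) (ZMod 2) => Y * R₀) h
    simpa only [Matrix.mul_assoc, hR₀, Matrix.mul_one] using h'
  · intro y hy
    simp only [Finset.mem_filter, Finset.mem_univ, true_and, tupleGram_eq] at hy
    obtain ⟨R, hR⟩ := exists_mul_eq_one_of_linearIndependent hy.1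
    -- `y` has the same row space as `x₀`, since the column space of the Gram matrix is both.
    have hyx : of y = Rᵀ * (of x₀)ᵀ * of x₀ := by
      rw [Matrix.mul_assoc, ← hy.2, ← Matrix.mul_assoc, ← Matrix.transpose_mul, hR,
        Matrix.transpose_one, Matrix.one_mul]
    refine ⟨Rᵀ * (of x₀)ᵀ, ?_, hyx.symm⟩
    simp only [Finset.mem_filter, Finset.mem_univ, true_and]
    have hM : Rᵀ * (of x₀)ᵀ = of y * R₀ := by
      rw [hyx, Matrix.mul_assoc _ _ R₀, hR₀, Matrix.mul_one]
    rw [hM]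
    calc (of y * R₀)ᵀ * (of y * R₀) = R₀ᵀ * ((of y)ᵀ * of y) * R₀ := by
          simp only [Matrix.transpose_mul, Matrix.mul_assoc]
      _ = (of x₀ * R₀)ᵀ * (of x₀ * R₀) := by
          rw [hy.2]
          simp only [Matrix.transpose_mul, Matrix.mul_assoc]
      _ = 1 := by rw [hR₀, Matrix.transpose_one, Matrix.one_mul]

open Classical in
lemma card_gram_fiber_le {k n : ℕ} (σ : Matrix (Fin n) (Fin n) (ZMod 2)) :
    (Finset.univ.filter fun x : Fin k → Qubits n =>
      LinearIndependent (ZMod 2) x ∧ tupleGram x = σ).card ≤ orthogonalCard k := by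
  rcases Finset.eq_empty_or_nonempty (Finset.univ.filter fun x : Fin k → Qubits n =>
      LinearIndependent (ZMod 2) x ∧ tupleGram x = σ) with h | ⟨x, hx⟩
  · rw [h]
    simp
  · simp only [Finset.mem_filter, Finset.mem_univ, true_and] at hx
    rw [← hx.2]
    exact (card_gram_fiber hx.1).le

lemma tupleGram_add {k m n : ℕ} (x : Fin (k + m) → Qubits n) :
    tupleGram x = tupleGram (x ∘ Fin.castAdd m) + tupleGram (x ∘ Fin.natAdd k) := by
  simp [tupleGram, Fin.sum_univ_add]

lemma eq_of_comp_castAdd_natAdd {α : Type*} {k m : ℕ} {x y : Fin (k + m) → α}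
    (h₁ : x ∘ Fin.castAdd m = y ∘ Fin.castAdd m) (h₂ : x ∘ Fin.natAdd k = y ∘ Fin.natAdd k) :
    x = y :=
  funext fun i => Fin.addCases (fun j => congrFun h₁ j) (fun j => congrFun h₂ j) i

open Classical in
/-- Once the last `m` entries are fixed, the Gram matrix of the first `k` is determined. -/
lemma card_gram_fiber_add_le {k m n : ℕ} (σ : Matrix (Fin n) (Fin n) (ZMod 2)) :
    (Finset.univ.filter fun x : Fin (k + m) → Qubits n =>
      LinearIndependent (ZMod 2) (x ∘ Fin.castAdd m) ∧ tupleGram x = σ).card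
        ≤ orthogonalCard k * (2 ^ n) ^ m := by
  have h := Finset.card_le_mul_card_image_of_maps_to
    (s := Finset.univ.filter fun x : Fin (k + m) → Qubits n =>
      LinearIndependent (ZMod 2) (x ∘ Fin.castAdd m) ∧ tupleGram x = σ)
    (f := fun x => x ∘ Fin.natAdd k) (t := Finset.univ) (fun _ _ => Finset.mem_univ _)
    (orthogonalCard k) fun z _ => ?_
  · simpa using h
  · refine le_trans (Finset.card_le_card_of_injOn (fun x => x ∘ Fin.castAdd m) ?_ ?_)
      (card_gram_fiber_le (σ - tupleGram z))
    · intro x hx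
      simp only [Finset.coe_filter, Finset.mem_filter, Finset.mem_univ, true_and,
        Set.mem_ofPred_eq] at hx ⊢
      refine ⟨hx.1.1, ?_⟩
      rw [← hx.1.2, tupleGram_add, hx.2, add_sub_cancel_right]
    · intro x hx y hy hxy
      simp only [Finset.coe_filter, Finset.mem_filter, Finset.mem_univ, true_and,
        Set.mem_ofPred_eq] at hx hy
      exact eq_of_comp_castAdd_natAdd hxy (hx.2.trans hy.2.symm)

/-- An orthogonal matrix of size `k + 1` is counted by its last row and its first `k` rows, which
then have a prescribed Gram matrix. -/
lemma orthogonalCard_succ_le (k : ℕ) : orthogonalCard (k + 1) ≤ orthogonalCard k * 2 ^ (k + 1) := by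
  have h := card_gram_fiber_add_le (k := k) (m := 1) (n := k + 1) 1
  rw [pow_one] at h
  refine le_trans (Finset.card_le_card_of_injOn of.symm (fun M hM => ?_)
    of.symm.injective.injOn) h
  simp only [Finset.coe_filter, Finset.mem_univ, true_and, Set.mem_ofPred_eq] at hM ⊢
  refine ⟨LinearIndependent.comp (v := of.symm M) ?_ _ (Fin.castAdd_injective k 1), ?_⟩
  · exact linearIndependent_of_mul_eq_one (R := Mᵀ) (mul_eq_one_comm.1 hM)
  · exact (tupleGram_eq _).trans hM

/-- A union bound: the factors `1 - 2^i / 2^n` multiply to at least `1 - 2^k / 2^n`. -/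
lemma two_pow_mul_le_prod_add {n : ℕ} (k : ℕ) (hk : k ≤ n) :
    2 ^ n * (2 ^ n) ^ k ≤ 2 ^ n * (∏ i : Fin k, (2 ^ n - 2 ^ i.val)) + 2 ^ k * (2 ^ n) ^ k := by
  induction k with
  | zero => simp
  | succ k ih =>
    have ih := ih (by omega)
    have hP : ∏ i : Fin k, (2 ^ n - 2 ^ i.val) ≤ (2 ^ n) ^ k := by
      refine (Finset.prod_le_pow_card _ _ _ fun i _ => Nat.sub_le _ _).trans ?_
      simp
    have hkn : 2 ^ k ≤ 2 ^ n := Nat.pow_le_pow_right (by norm_num) (by omega)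
    rw [Fin.prod_univ_castSucc]
    simp only [Fin.val_castSucc, Fin.val_last]
    obtain ⟨d, hd⟩ := Nat.exists_eq_add_of_le hkn
    rw [hd, Nat.add_sub_cancel_left, ← hd]
    generalize ∏ i : Fin k, (2 ^ n - 2 ^ i.val) = P at *
    rw [pow_succ (2 ^ n) k, pow_succ 2 k]
    generalize (2 ^ n) ^ k = Q at *
    generalize 2 ^ k = a at *
    generalize 2 ^ n = q at *
    have h1 := Nat.mul_le_mul_right q ih
    have h2 := Nat.mul_le_mul_left (q * a) hP
    have h3 : q * P * q = q * (P * d) + q * a * P := by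
      subst hd
      ring
    nlinarith

open Classical in
/-- At most a fraction `2 ^ k / 2 ^ n` of the `k`-tuples of `n`-bit strings is dependent. -/
lemma card_not_linearIndependent_le {k n : ℕ} (hk : k ≤ n) :
    2 ^ n * (Finset.univ.filter fun x : Fin k → Qubits n =>
      ¬ LinearIndependent (ZMod 2) x).card ≤ 2 ^ k * (2 ^ n) ^ k := by
  have h := card_linearIndependent (K := ZMod 2) (V := Qubits n) (k := k) (by simpa using hk)
  rw [Nat.card_eq_fintype_card, Fintype.card_subtype] at h
  simp only [ZMod.card, Module.finrank_fin_fun] at h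
  have h1 := two_pow_mul_le_prod_add k hk
  have h2 := Finset.card_filter_add_card_filter_not (s := Finset.univ)
    (fun x : Fin k → Qubits n => LinearIndependent (ZMod 2) x)
  rw [h] at h2
  have h3 : (Finset.univ : Finset (Fin k → Qubits n)).card = (2 ^ n) ^ k := by simp
  rw [h3] at h2
  rw [← h2, Nat.mul_add] at h1
  rw [h2] at h1
  omega

open Classical in
lemma card_not_linearIndependent_add_le {k n : ℕ} (m : ℕ) (hk : k ≤ n) :
    2 ^ n * (Finset.univ.filter fun x : Fin (k + m) → Qubits n =>
      ¬ LinearIndependent (ZMod 2) (x ∘ Fin.castAdd m)).card ≤ 2 ^ k * (2 ^ n) ^ (k + m) := by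
  have h := Finset.card_le_mul_card_image_of_maps_to
    (s := Finset.univ.filter fun x : Fin (k + m) → Qubits n =>
      ¬ LinearIndependent (ZMod 2) (x ∘ Fin.castAdd m))
    (f := fun x => x ∘ Fin.natAdd k) (t := Finset.univ) (fun _ _ => Finset.mem_univ _)
    (Finset.univ.filter fun x : Fin k → Qubits n => ¬ LinearIndependent (ZMod 2) x).card
    fun z _ => ?_
  · calc _ ≤ 2 ^ n * _ := Nat.mul_le_mul_left _ h
      _ = (2 ^ n * (Finset.univ.filter fun x : Fin k → Qubits n =>
            ¬ LinearIndependent (ZMod 2) x).card) * (2 ^ n) ^ m := by simp [mul_assoc]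
      _ ≤ _ := Nat.mul_le_mul_right _ (card_not_linearIndependent_le hk)
      _ = _ := by ring
  · refine Finset.card_le_card_of_injOn (fun x => x ∘ Fin.castAdd m) ?_ ?_
    · intro x hx
      simp only [Finset.coe_filter, Finset.mem_filter, Finset.mem_univ, true_and,
        Set.mem_ofPred_eq] at hx ⊢
      exact hx.1
    · intro x hx y hy hxy
      simp only [Finset.coe_filter, Finset.mem_filter, Finset.mem_univ, true_and,
        Set.mem_ofPred_eq] at hx hy
      exact eq_of_comp_castAdd_natAdd hxy (hx.2.trans hy.2.symm)

open Classical in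
/-- All nonempty fibres of `tupleGram` on independent tuples have the same size, so few Gram matrices
occur. -/
lemma card_image_gram_mul {k n : ℕ} :
    ((Finset.univ.filter fun x : Fin k → Qubits n =>
      LinearIndependent (ZMod 2) x).image tupleGram).card
      * orthogonalCard k ≤ (2 ^ n) ^ k := by
  have h := Finset.card_eq_sum_card_image tupleGram
    (Finset.univ.filter fun x : Fin k → Qubits n => LinearIndependent (ZMod 2) x)
  rw [Finset.sum_congr rfl (g := fun _ => orthogonalCard k), Finset.sum_const, smul_eq_mul] at h
  · rw [← h]
    refine (Finset.card_le_univ _).trans ?_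
    simp
  · intro σ hσ
    obtain ⟨x, hx, rfl⟩ := Finset.mem_image.1 hσ
    rw [Finset.filter_filter]
    exact card_gram_fiber (by simpa using hx)

/-! ### Quadratic phase states are stabilizer states -/

/-- The nontrivial character of `𝔽₂`. -/
noncomputable def sgn (a : ZMod 2) : ℝ := (-1) ^ a.val

@[simp] lemma sgn_zero : sgn 0 = 1 := by simp [sgn]

lemma sgn_one : sgn 1 = -1 := by simp [sgn, ZMod.val_one]

lemma sgn_add (a b : ZMod 2) : sgn (a + b) = sgn a * sgn b := by
  have h2 : (1 + 1 : ZMod 2) = 0 := rfl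
  have h : ∀ c : ZMod 2, c = 0 ∨ c = 1 := by decide
  rcases h a with rfl | rfl <;> rcases h b with rfl | rfl <;> simp [sgn_one, h2]

@[simp] lemma sgn_mul_self (a : ZMod 2) : sgn a * sgn a = 1 := by
  rw [← sgn_add, CharTwo.add_self_eq_zero, sgn_zero]

lemma sgn_sum {κ : Type*} (S : Finset κ) (a : κ → ZMod 2) :
    sgn (∑ i ∈ S, a i) = ∏ i ∈ S, sgn (a i) := by
  classical
  induction S using Finset.induction_on with
  | empty => simp
  | insert i S hi ih => rw [Finset.sum_insert hi, Finset.prod_insert hi, sgn_add, ih]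

/-- The entrywise pairing `∑ᵢⱼ Aᵢⱼ σᵢⱼ` of matrices over `𝔽₂`. -/
def pairing {n : ℕ} (A σ : Matrix (Fin n) (Fin n) (ZMod 2)) : ZMod 2 :=
  ∑ i, ∑ j, A i j * σ i j

lemma pairing_add_left {n : ℕ} (A B σ : Matrix (Fin n) (Fin n) (ZMod 2)) :
    pairing (A + B) σ = pairing A σ + pairing B σ := by
  simp [pairing, add_mul, Finset.sum_add_distrib]

lemma pairing_add_right {n : ℕ} (A σ τ : Matrix (Fin n) (Fin n) (ZMod 2)) :
    pairing A (σ + τ) = pairing A σ + pairing A τ := by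
  simp [pairing, mul_add, Finset.sum_add_distrib]

lemma pairing_sum_right {n : ℕ} {κ : Type*} (A : Matrix (Fin n) (Fin n) (ZMod 2)) (S : Finset κ)
    (σ : κ → Matrix (Fin n) (Fin n) (ZMod 2)) :
    pairing A (∑ k ∈ S, σ k) = ∑ k ∈ S, pairing A (σ k) :=
  map_sum (⟨⟨pairing A, by simp [pairing]⟩, pairing_add_right A⟩ :
    Matrix (Fin n) (Fin n) (ZMod 2) →+ ZMod 2) σ S

lemma pairing_single {n : ℕ} (i j : Fin n) (σ : Matrix (Fin n) (Fin n) (ZMod 2)) :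
    pairing (Matrix.single i j 1) σ = σ i j := by
  simp [pairing, Matrix.single_apply, ite_and]

/-- Orthogonality of characters of the group of `n × n` matrices over `𝔽₂`. -/
lemma sum_sgn_pairing_mul {n : ℕ} (σ τ : Matrix (Fin n) (Fin n) (ZMod 2)) :
    ∑ A, sgn (pairing A σ) * sgn (pairing A τ)
      = if σ = τ then (Fintype.card (Matrix (Fin n) (Fin n) (ZMod 2)) : ℝ) else 0 := by
  split_ifs with h
  · subst h
    simp
  · obtain ⟨i, j, hij⟩ : ∃ i j, σ i j + τ i j = 1 := by
      by_contra hc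
      push Not at hc
      refine h (Matrix.ext fun i j => ?_)
      have hc := hc i j
      generalize σ i j = a at *
      generalize τ i j = b at *
      revert a b
      decide
    -- Translating `A` by the elementary matrix at `(i, j)` flips the sign of every term.
    have hs := Equiv.sum_comp (Equiv.addRight (Matrix.single i j (1 : ZMod 2)))
      fun A => sgn (pairing A σ) * sgn (pairing A τ)
    simp only [Equiv.coe_addRight, pairing_add_left, pairing_single, sgn_add] at hs
    have hflip : sgn (σ i j) * sgn (τ i j) = -1 := by rw [← sgn_add, hij, sgn_one]
    have : ∀ A : Matrix (Fin n) (Fin n) (ZMod 2),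
        sgn (pairing A σ) * sgn (σ i j) * (sgn (pairing A τ) * sgn (τ i j))
          = -(sgn (pairing A σ) * sgn (pairing A τ)) := fun A => by
      linear_combination (sgn (pairing A σ) * sgn (pairing A τ)) * hflip
    simp only [this, Finset.sum_neg_distrib] at hs
    linarith

lemma Qubits.add_add_self {n : ℕ} (x b : Qubits n) : x + b + b = x := by
  funext i
  simp [add_assoc, CharTwo.add_self_eq_zero]

/-- The sign `(-1)^(xᵀ A x)`. -/
noncomputable def quadSign {n : ℕ} (A : Matrix (Fin n) (Fin n) (ZMod 2)) (x : Qubits n) : ℝ :=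
  sgn (pairing A (vecMulVec x x))

/-- The quadratic phase state `2^(-n/2) ∑ₓ (-1)^(xᵀ A x) |x⟩`. -/
noncomputable def phaseState {n : ℕ} (A : Matrix (Fin n) (Fin n) (ZMod 2)) (x : Qubits n) : ℝ :=
  (Real.sqrt (2 ^ n))⁻¹ * quadSign A x

@[simp] lemma quadSign_mul_self {n : ℕ} (A : Matrix (Fin n) (Fin n) (ZMod 2)) (x : Qubits n) :
    quadSign A x * quadSign A x = 1 := sgn_mul_self _

lemma quadSign_add {n : ℕ} (A : Matrix (Fin n) (Fin n) (ZMod 2)) (x b : Qubits n) :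
    quadSign A (x + b) = quadSign A x * quadSign A b * ∏ i, sgn (x i * ((A + Aᵀ) *ᵥ b) i) := by
  rw [← sgn_sum, quadSign, quadSign, quadSign, ← sgn_add, ← sgn_add]
  congr 1
  have h : ∑ i, x i * ((A + Aᵀ) *ᵥ b) i
      = pairing A (vecMulVec x b) + pairing A (vecMulVec b x) := by
    simp only [pairing, mulVec, dotProduct, Matrix.add_apply, Matrix.transpose_apply, add_mul,
      Finset.sum_add_distrib, mul_add, vecMulVec_apply, Finset.mul_sum]
    congr 1
    · exact Finset.sum_congr rfl fun i _ => Finset.sum_congr rfl fun j _ => by ring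
    · rw [Finset.sum_comm]
      exact Finset.sum_congr rfl fun i _ => Finset.sum_congr rfl fun j _ => by ring
  rw [h, add_vecMulVec, vecMulVec_add, vecMulVec_add]
  simp only [pairing_add_right]
  ring

/-- The operator `|x⟩ ↦ |x + b⟩` conjugated by the diagonal unitary with entries `(-1)^(xᵀ A x)`. -/
noncomputable def phaseShift {n : ℕ} (A : Matrix (Fin n) (Fin n) (ZMod 2)) (b : Qubits n) :
    QOp n :=
  of fun x y => if x = y + b then ((quadSign A x * quadSign A y : ℝ) : ℂ) else 0

lemma phaseShift_zero {n : ℕ} (A : Matrix (Fin n) (Fin n) (ZMod 2)) : phaseShift A 0 = 1 := by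
  ext x y
  by_cases h : x = y
  · subst h
    rw [phaseShift, of_apply, if_pos (add_zero x).symm, quadSign_mul_self]
    simp
  · simp [phaseShift, h]

lemma phaseShift_mul {n : ℕ} (A : Matrix (Fin n) (Fin n) (ZMod 2)) (b c : Qubits n) :
    phaseShift A b * phaseShift A c = phaseShift A (b + c) := by
  ext x y
  rw [Matrix.mul_apply, Finset.sum_eq_single (y + c)]
  · simp only [phaseShift, of_apply, if_true]
    rw [add_comm b c, ← add_assoc]
    split_ifs
    · rw [← Complex.ofReal_mul]
      congr 1
      linear_combination (quadSign A x * quadSign A y) * quadSign_mul_self A (y + c)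
    · simp
  · intro z _ hz
    simp [phaseShift, hz]
  · simp

/-- `b ↦ phaseShift A b` as a homomorphism into the invertible operators. -/
noncomputable def phaseShiftHom {n : ℕ} (A : Matrix (Fin n) (Fin n) (ZMod 2)) :
    Multiplicative (Qubits n) →* (QOp n)ˣ :=
  MonoidHom.toHomUnits
    { toFun := fun b => phaseShift A b.toAdd
      map_one' := phaseShift_zero A
      map_mul' := fun _ _ => (phaseShift_mul A _ _).symm }

lemma phaseShiftHom_injective {n : ℕ} (A : Matrix (Fin n) (Fin n) (ZMod 2)) :
    Function.Injective (phaseShiftHom A) := by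
  intro b c h
  have h : phaseShift A b.toAdd b.toAdd 0 = phaseShift A c.toAdd b.toAdd 0 :=
    congrArg (fun u : (QOp n)ˣ => (u : QOp n) b.toAdd 0) h
  by_contra hbc
  have hne : ∀ x, quadSign A x ≠ 0 := fun x hx => by simpa [hx] using quadSign_mul_self A x
  have hbc' : b.toAdd ≠ c.toAdd := fun h => hbc (Multiplicative.toAdd.injective h)
  simp [phaseShift, hbc', hne] at h

lemma pauli_entry (a b x y : ZMod 2) :
    (pauliZ ^ a.val * pauliX ^ b.val : Matrix (ZMod 2) (ZMod 2) ℂ) x y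
      = if x = y + b then ((sgn (x * a) : ℝ) : ℂ) else 0 := by
  have h : ∀ c : ZMod 2, c = 0 ∨ c = 1 := by decide
  have h2 : (1 + 1 : ZMod 2) = 0 := rfl
  have h10 : (1 : ZMod 2) ≠ 0 := by decide
  have h01 : (0 : ZMod 2) ≠ 1 := by decide
  rcases h a with rfl | rfl <;> rcases h b with rfl | rfl <;> rcases h x with rfl | rfl <;>
    rcases h y with rfl | rfl <;>
    simp [pauliZ, pauliX, sgn_one, h2, ZMod.val_one]

lemma weyl_apply {n : ℕ} (a b x y : Qubits n) :
    weyl a b x y = if x = y + b then ((∏ i, sgn (x i * a i) : ℝ) : ℂ) else 0 := by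
  simp only [weyl, tensorProd, of_apply, pauli_entry]
  by_cases h : x = y + b
  · subst h
    simp
  · rw [if_neg h]
    obtain ⟨i, hi⟩ := Function.ne_iff.1 h
    exact Finset.prod_eq_zero (Finset.mem_univ i) (if_neg hi)

lemma isPauli_phaseShift {n : ℕ} (A : Matrix (Fin n) (Fin n) (ZMod 2)) (b : Qubits n) :
    IsPauli (phaseShift A b) := by
  have hb : quadSign A b = 1 ∨ quadSign A b = -1 :=
    mul_self_eq_one_iff.1 (quadSign_mul_self A b)
  obtain ⟨k, hk⟩ : ∃ k : ℕ, Complex.I ^ k = (quadSign A b : ℂ) := by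
    rcases hb with h | h
    · exact ⟨0, by simp [h]⟩
    · exact ⟨2, by simp [h]⟩
  refine ⟨k, (A + Aᵀ) *ᵥ b, b, ?_⟩
  ext x y
  rw [Matrix.smul_apply, weyl_apply, hk]
  by_cases h : x = y + b
  · have hy : y = x + b := by
      rw [h, Qubits.add_add_self]
    simp only [phaseShift, of_apply, if_pos h]
    rw [smul_eq_mul, ← Complex.ofReal_mul]
    congr 1
    rw [hy, quadSign_add]
    linear_combination (quadSign A b * ∏ i, sgn (x i * ((A + Aᵀ) *ᵥ b) i)) * quadSign_mul_self A x
  · simp [phaseShift, h]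

lemma phaseShift_mulVec {n : ℕ} (A : Matrix (Fin n) (Fin n) (ZMod 2)) (b : Qubits n) :
    phaseShift A b *ᵥ (fun x => (phaseState A x : ℂ)) = fun x => (phaseState A x : ℂ) := by
  funext x
  rw [mulVec, dotProduct, Finset.sum_eq_single (x + b)]
  · have h : x = x + b + b := (Qubits.add_add_self x b).symm
    simp only [phaseShift, of_apply, if_pos h]
    rw [← Complex.ofReal_mul]
    congr 1
    unfold phaseState
    linear_combination
      (quadSign A x * (Real.sqrt (2 ^ n))⁻¹) * quadSign_mul_self A (x + b)
  · intro y _ hy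
    have h : ¬ x = y + b := fun h => hy (by
      rw [h, Qubits.add_add_self])
    simp [phaseShift, h]
  · simp

lemma phaseState_sq {n : ℕ} (A : Matrix (Fin n) (Fin n) (ZMod 2)) (x : Qubits n) :
    phaseState A x ^ 2 = (2 ^ n)⁻¹ := by
  rw [phaseState, mul_pow, inv_pow, Real.sq_sqrt (by positivity), sq, quadSign_mul_self, mul_one]

lemma isStabilizerVector_phaseState {n : ℕ} (A : Matrix (Fin n) (Fin n) (ZMod 2)) :
    IsStabilizerVector fun x => (phaseState A x : ℂ) := by
  refine ⟨?_, (phaseShiftHom A).range, ?_, ?_, ?_⟩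
  · simp [phaseState_sq]
  · rintro _ ⟨b, rfl⟩
    exact isPauli_phaseShift A _
  · rw [Nat.card_congr (MonoidHom.ofInjective (phaseShiftHom_injective A)).symm.toEquiv]
    simp [Nat.card_eq_fintype_card]
  · rintro _ ⟨b, rfl⟩
    exact phaseShift_mulVec A _

/-- The `t`-fold tensor power of a quadratic phase state. Its sign at a tuple depends only on the
Gram matrix of the tuple. -/
noncomputable def phasePower {n : ℕ} (t : ℕ) (A : Matrix (Fin n) (Fin n) (ZMod 2))
    (x : Fin t → Qubits n) : ℝ :=
  (Real.sqrt (2 ^ n))⁻¹ ^ t * sgn (pairing A (tupleGram x))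

lemma prod_phaseState {n t : ℕ} (A : Matrix (Fin n) (Fin n) (ZMod 2)) (x : Fin t → Qubits n) :
    ∏ i, phaseState A (x i) = phasePower t A x := by
  simp [phaseState, phasePower, Finset.prod_mul_distrib, tupleGram, pairing_sum_right, sgn_sum,
    quadSign]

lemma copies_ketBra_phaseState {n : ℕ} (t : ℕ) (A : Matrix (Fin n) (Fin n) (ZMod 2)) :
    copies t (ketBra fun x => (phaseState A x : ℂ)) = realKetBra (phasePower t A) := by
  ext x y
  simp only [copies, tensorProd, ketBra, of_apply, realKetBra_apply, ← prod_phaseState,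
    vecMulVec_apply, Pi.star_apply, Complex.star_def, Complex.conj_ofReal,
    Finset.prod_mul_distrib, Complex.ofReal_mul, Complex.ofReal_prod]

lemma phasePower_sq {n t : ℕ} (A : Matrix (Fin n) (Fin n) (ZMod 2)) (x : Fin t → Qubits n) :
    phasePower t A x ^ 2 = ((2 ^ n) ^ t)⁻¹ := by
  rw [← prod_phaseState, ← Finset.prod_pow]
  simp [phaseState_sq]

lemma ketBra_phaseState_mem_stab {n : ℕ} (A : Matrix (Fin n) (Fin n) (ZMod 2)) :
    (ketBra fun x => (phaseState A x : ℂ)) ∈ Stab n :=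
  ⟨_, isStabilizerVector_phaseState A, rfl⟩

/-! ### Positive maps on ensembles of phase vectors -/

section PhaseEnsemble

variable {n : ℕ} {X Y : Type*}

/-- Averaging `|g_A⟩⟨g_A|` over `A` decouples the classes of `h`, and each class contributes at most
its size times the diagonal of `B` on it. -/
lemma sum_expectation_sgn_le [Fintype Y] [DecidableEq Y] (h : Y → Matrix (Fin n) (Fin n) (ZMod 2))
    (P : Finset Y) (N : ℕ)
    (hN : ∀ σ, (P.filter fun y => h y = σ).card ≤ N) {B : Matrix Y Y ℂ} (hB : B.PosSemidef) :
    ∑ A, expectation (fun y => if y ∈ P then sgn (pairing A (h y)) else 0) B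
      ≤ Fintype.card (Matrix (Fin n) (Fin n) (ZMod 2)) * (N * B.trace.re) := by
  set W : Y → Y → ℝ := fun x y => if x ∈ P ∧ y ∈ P ∧ h x = h y then 1 else 0 with hW
  have hWsymm : ∀ x y, W x y = W y x := fun x y => by
    simp only [hW]
    congr 1
    exact propext ⟨fun ⟨a, b, c⟩ => ⟨b, a, c.symm⟩, fun ⟨a, b, c⟩ => ⟨b, a, c.symm⟩⟩
  have hWnn : ∀ x y, 0 ≤ W x y := fun x y => by
    simp only [hW]
    split_ifs <;> norm_num
  have hWsum : ∀ x, ∑ y, W x y ≤ N := fun x => by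
    by_cases hx : x ∈ P
    · have h1 : ∑ y, W x y = ((P.filter fun y => h y = h x).card : ℝ) := by
        simp only [hW, hx, true_and, Finset.sum_boole]
        congr 2
        ext y
        simp [eq_comm]
      rw [h1]
      exact_mod_cast hN (h x)
    · simp [hW, hx]
  have hdiag : ∀ x, 0 ≤ (B x x).re := fun x => (Complex.le_def.1 hB.diag_nonneg).1
  have h1 : ∑ A, expectation (fun y => if y ∈ P then sgn (pairing A (h y)) else 0) B
      = Fintype.card (Matrix (Fin n) (Fin n) (ZMod 2)) * ∑ x, ∑ y, W x y * (B x y).re := by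
    simp only [expectation]
    rw [Finset.sum_comm, Finset.mul_sum]
    refine Finset.sum_congr rfl fun x _ => ?_
    rw [Finset.sum_comm, Finset.mul_sum]
    refine Finset.sum_congr rfl fun y _ => ?_
    rw [← Finset.sum_mul, ← mul_assoc]
    congr 1
    by_cases hx : x ∈ P <;> by_cases hy : y ∈ P <;> simp [hW, hx, hy, sum_sgn_pairing_mul]
  rw [h1]
  refine mul_le_mul_of_nonneg_left ?_ (Nat.cast_nonneg _)
  calc ∑ x, ∑ y, W x y * (B x y).re
      ≤ ∑ x, ∑ y, (W x y * (B x x).re / 2 + W y x * (B y y).re / 2) := by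
        refine Finset.sum_le_sum fun x _ => Finset.sum_le_sum fun y _ => ?_
        have h2 := two_mul_re_le_of_posSemidef hB x y 1 1
        rw [hWsymm y x]
        nlinarith [mul_le_mul_of_nonneg_left h2 (hWnn x y)]
    _ = ∑ x, (∑ y, W x y) * (B x x).re := by
        simp only [Finset.sum_add_distrib]
        rw [Finset.sum_comm (f := fun x y => W y x * (B y y).re / 2), ← Finset.sum_add_distrib]
        refine Finset.sum_congr rfl fun x _ => ?_
        rw [← Finset.sum_add_distrib, Finset.sum_mul]
        exact Finset.sum_congr rfl fun y _ => by ring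
    _ ≤ ∑ x, N * (B x x).re :=
        Finset.sum_le_sum fun x _ => mul_le_mul_of_nonneg_right (hWsum x) (hdiag x)
    _ = N * B.trace.re := by rw [re_trace, Finset.mul_sum]

lemma expectation_map_mono [Fintype Y] {Λ : Matrix X X ℂ →ₗ[ℂ] Matrix Y Y ℂ}
    (hpos : ∀ M : Matrix X X ℂ, M.PosSemidef → (Λ M).PosSemidef) (g : Y → ℝ)
    {A B : Matrix X X ℂ} (hAB : (B - A).PosSemidef) :
    expectation g (Λ A) ≤ expectation g (Λ B) := by
  have h := expectation_nonneg g (hpos _ hAB)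
  rw [map_sub, expectation_sub] at h
  linarith

/-- The vector with entries `1` on the part of the class `f = σ` inside `G`, and `0` elsewhere. -/
noncomputable def classVector [DecidableEq X] (f : X → Matrix (Fin n) (Fin n) (ZMod 2))
    (G : Finset X)
    (σ : Matrix (Fin n) (Fin n) (ZMod 2)) (x : X) : ℝ :=
  if x ∈ G ∧ f x = σ then 1 else 0

lemma sum_classVector [DecidableEq X] (f : X → Matrix (Fin n) (Fin n) (ZMod 2)) (G : Finset X)
    (a : Matrix (Fin n) (Fin n) (ZMod 2) → ℝ) (x : X) :
    ∑ σ ∈ G.image f, a σ * classVector f G σ x = if x ∈ G then a (f x) else 0 := by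
  split_ifs with hx
  · rw [Finset.sum_eq_single (f x)]
    · simp [classVector, hx]
    · intro σ _ hσ
      simp [classVector, hσ.symm]
    · intro h
      exact absurd (Finset.mem_image_of_mem f hx) h
  · exact Finset.sum_eq_zero fun σ _ => by simp [classVector, hx]

/-- A positive trace-preserving map cannot turn the phase vectors `u_A = c · χ_A ∘ f` into ones that
overlap much with `g_A = d · χ_A ∘ h` (restricted to `P`) on average over `A`. On `G`, each
`|u_A⟩⟨u_A|` is dominated by one operator independent of `A`; outside `G`, the trace is small. -/
lemma sum_expectation_map_le [Fintype X] [Fintype Y] [DecidableEq X] [DecidableEq Y]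
    {Λ : Matrix X X ℂ →ₗ[ℂ] Matrix Y Y ℂ}
    (hpos : ∀ M : Matrix X X ℂ, M.PosSemidef → (Λ M).PosSemidef)
    (htr : ∀ M, (Λ M).trace = M.trace)
    (f : X → Matrix (Fin n) (Fin n) (ZMod 2)) (h : Y → Matrix (Fin n) (Fin n) (ZMod 2))
    (G : Finset X) (P : Finset Y) (N : ℕ) (hN : ∀ σ, (P.filter fun y => h y = σ).card ≤ N)
    (c d : ℝ) (hd : d ^ 2 * P.card ≤ 1) :
    ∑ A, expectation (fun y => if y ∈ P then d * sgn (pairing A (h y)) else 0)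
        (Λ (realKetBra fun x => c * sgn (pairing A (f x))))
      ≤ Fintype.card (Matrix (Fin n) (Fin n) (ZMod 2)) *
          (2 * (d ^ 2 * c ^ 2 * (G.image f).card * N * G.card) + 2 * (c ^ 2 * Gᶜ.card)) := by
  set Ω : Matrix X X ℂ := ∑ σ ∈ G.image f, realKetBra (classVector f G σ) with hΩ
  have hΩpos : Ω.PosSemidef := posSemidef_sum _ fun σ _ => posSemidef_realKetBra _
  have hΩtr : Ω.trace.re = G.card := by
    have h1 : ∀ x, (Ω x x).re = if x ∈ G then 1 else 0 := fun x => by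
      rw [← sum_classVector f G (fun _ => 1) x, hΩ, Matrix.sum_apply, Complex.re_sum]
      refine Finset.sum_congr rfl fun σ _ => ?_
      rw [realKetBra_apply, Complex.ofReal_re]
      simp only [classVector]
      split_ifs <;> simp
    rw [re_trace, Finset.sum_congr rfl fun x _ => h1 x]
    simp
  set g : Matrix (Fin n) (Fin n) (ZMod 2) → Y → ℝ :=
    fun A y => if y ∈ P then sgn (pairing A (h y)) else 0 with hg
  have hgd : ∀ A, (fun y => if y ∈ P then d * sgn (pairing A (h y)) else 0) = d • g A := fun A => by
    funext y
    simp [hg]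
  have hg1 : ∀ A, ∑ y, (d • g A) y ^ 2 ≤ 1 := fun A => by
    refine le_trans (le_of_eq ?_) hd
    rw [← Finset.sum_filter_add_sum_filter_not Finset.univ (· ∈ P)]
    rw [Finset.sum_congr rfl (g := fun _ => d ^ 2),
      Finset.sum_eq_zero (s := Finset.filter (· ∉ P) _)]
    · simp [mul_comm]
    · intro y hy
      simp [hg, (Finset.mem_filter.1 hy).2]
    · intro y hy
      simp [hg, (Finset.mem_filter.1 hy).2, mul_pow, sq (sgn _)]
  have hA : ∀ A, expectation (d • g A) (Λ (realKetBra fun x => c * sgn (pairing A (f x))))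
      ≤ 2 * (c ^ 2 * (G.image f).card * d ^ 2 * expectation (g A) (Λ Ω))
        + 2 * (c ^ 2 * Gᶜ.card) := fun A => by
    -- The cross terms between `G` and its complement cost a factor `2`.
    set u₁ : X → ℝ := fun x => if x ∈ G then c * sgn (pairing A (f x)) else 0 with hu₁
    set u₂ : X → ℝ := fun x => if x ∈ G then 0 else c * sgn (pairing A (f x)) with hu₂
    have hsplit : (fun x => c * sgn (pairing A (f x))) = ∑ i, ![u₁, u₂] i := by
      funext x
      by_cases hx : x ∈ G <;> simp [Fin.sum_univ_two, hu₁, hu₂, hx]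
    have h1 := expectation_map_mono hpos (d • g A)
      (posSemidef_card_smul_sum_sub Finset.univ ![u₁, u₂])
    rw [← hsplit, map_smul, expectation_smul, Fin.sum_univ_two, map_add, expectation_add] at h1
    simp only [Matrix.cons_val_zero, Matrix.cons_val_one, Finset.card_univ, Fintype.card_fin,
      Nat.succ_eq_add_one, Nat.reduceAdd, Nat.cast_ofNat] at h1
    have h2 : expectation (d • g A) (Λ (realKetBra u₂)) ≤ c ^ 2 * Gᶜ.card := by
      refine (expectation_le_trace (hg1 A) (hpos _ (posSemidef_realKetBra _))).trans
        (le_of_eq ?_)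
      rw [htr, trace_realKetBra, Complex.ofReal_re]
      have h3 : ∀ x, u₂ x ^ 2 = if x ∈ Gᶜ then c ^ 2 else 0 := fun x => by
        by_cases hx : x ∈ G <;> simp [hu₂, hx, mul_pow, sq (sgn _)]
      rw [Finset.sum_congr rfl fun x _ => h3 x, Finset.sum_ite_mem, Finset.univ_inter,
        Finset.sum_const, nsmul_eq_mul, mul_comm]
    have h4 : expectation (d • g A) (Λ (realKetBra u₁))
        ≤ c ^ 2 * (G.image f).card * d ^ 2 * expectation (g A) (Λ Ω) := by
      have h5 := expectation_map_mono hpos (d • g A) (posSemidef_card_smul_sum_sub (G.image f)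
        fun σ => (c * sgn (pairing A σ)) • classVector f G σ)
      have h6 : ∑ σ ∈ G.image f, (c * sgn (pairing A σ)) • classVector f G σ = u₁ := by
        funext x
        rw [Finset.sum_apply]
        exact sum_classVector f G (fun σ => c * sgn (pairing A σ)) x
      have h7 : ∑ σ ∈ G.image f, realKetBra ((c * sgn (pairing A σ)) • classVector f G σ)
          = ((c ^ 2 : ℝ) : ℂ) • Ω := by
        rw [hΩ, Finset.smul_sum]
        refine Finset.sum_congr rfl fun σ _ => ?_
        ext x y
        rw [Matrix.smul_apply, realKetBra_apply, realKetBra_apply, smul_eq_mul,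
          ← Complex.ofReal_mul]
        congr 1
        simp only [Pi.smul_apply, smul_eq_mul]
        linear_combination
          (c ^ 2 * classVector f G σ x * classVector f G σ y) * sgn_mul_self (pairing A σ)
      rw [h6, h7, map_smul, map_smul, expectation_smul, expectation_smul] at h5
      refine h5.trans (le_of_eq ?_)
      rw [expectation_smul_vec]
      ring
    linarith
  have hav := sum_expectation_sgn_le h P N hN (hpos _ hΩpos)
  rw [htr, hΩtr] at hav
  simp only [hgd]
  refine (Finset.sum_le_sum fun A _ => hA A).trans ?_
  rw [Finset.sum_add_distrib, ← Finset.mul_sum, ← Finset.mul_sum, Finset.sum_const,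
    Finset.card_univ, nsmul_eq_mul]
  have hk : 0 ≤ c ^ 2 * ((G.image f).card : ℝ) * d ^ 2 := by positivity
  have := mul_le_mul_of_nonneg_left hav hk
  linarith

end PhaseEnsemble

open scoped MatrixOrder Matrix.Norms.L2Operator CStarAlgebra in
/-- Of complete positivity, only positivity of the cloning map itself is used. -/
lemma AdmitsCloning.exists_linearMap {n s t : ℕ} {𝒮 : Set (QOp n)} {ε : ℝ}
    (h : AdmitsCloning 𝒮 s t ε) :
    ∃ Λ : QOpPow n s →ₗ[ℂ] QOpPow n t, (∀ M : QOpPow n s, M.PosSemidef → (Λ M).PosSemidef) ∧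
      (∀ M : QOpPow n s, (Λ M).trace = M.trace) ∧
        ∀ ρ ∈ 𝒮, traceDist (Λ (copies s ρ)) (copies t ρ) ≤ ε := by
  obtain ⟨Λ, htr, hΛ⟩ := h
  exact ⟨Λ.toLinearMap, fun M hM => (map_nonneg Λ hM.nonneg).posSemidef, htr, hΛ⟩

/-! ### The cloning bound -/

/-- No `s` copies of a stabilizer state give `s + 1 + m` copies when `4 (s + 1) ≤ n`. The test
vectors are the tensor powers of the phase states, cut down to the tuples whose first `s + 1`
strings are independent; this cut makes a partial trace over the last `m` copies unnecessary. -/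
lemma not_admitsCloning_stab {n s m : ℕ} {ε : ℝ} (hε : ε ≤ 0.14) (hs : 4 * (s + 1) ≤ n) :
    ¬ AdmitsCloning (Stab n) s (s + 1 + m) ε := by
  classical
  intro hclone
  obtain ⟨Λ, hpos, htr, hΛ⟩ := hclone.exists_linearMap
  set G : Finset (Fin s → Qubits n) :=
    Finset.univ.filter fun x => LinearIndependent (ZMod 2) x with hG
  set P : Finset (Fin (s + 1 + m) → Qubits n) :=
    Finset.univ.filter fun x => LinearIndependent (ZMod 2) (x ∘ Fin.castAdd m) with hP
  set r : ℝ := (Real.sqrt (2 ^ n))⁻¹ with hr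
  have hr2 : r ^ 2 = (2 ^ n)⁻¹ := by
    rw [hr, inv_pow, Real.sq_sqrt (by positivity)]
  have hq : (0 : ℝ) < 2 ^ n := by positivity
  have hsq : ∀ t, (r ^ t) ^ 2 = ((2 ^ n) ^ t)⁻¹ := fun t => by
    rw [← pow_mul, mul_comm, pow_mul, hr2, inv_pow]
  have hpow : (2 : ℝ) ^ s * 16 ≤ 2 ^ n := by
    rw [show (16 : ℝ) = 2 ^ 4 by norm_num, ← pow_add]
    exact pow_le_pow_right₀ (by norm_num) (by omega)
  have hGc : (r ^ s) ^ 2 * (Gᶜ.card : ℝ) ≤ 1 / 16 := by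
    have h := card_not_linearIndependent_le (k := s) (n := n) (by omega)
    rw [← Finset.compl_filter, ← hG] at h
    have h : (2 : ℝ) ^ n * Gᶜ.card ≤ 2 ^ s * (2 ^ n) ^ s := by exact_mod_cast h
    rw [hsq, inv_mul_le_iff₀ (by positivity)]
    have := mul_le_mul_of_nonneg_right hpow (show (0 : ℝ) ≤ (2 ^ n) ^ s by positivity)
    refine le_of_mul_le_mul_left ?_ hq
    linarith
  have hcardY : (P.card : ℝ) + Pᶜ.card = (2 ^ n) ^ (s + 1 + m) := by
    have := Finset.card_add_card_compl P
    simp only [Fintype.card_fun, ZMod.card, Fintype.card_fin] at this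
    exact_mod_cast this
  have hPc : 7 / 8 ≤ (r ^ (s + 1 + m)) ^ 2 * (P.card : ℝ) := by
    have h := card_not_linearIndependent_add_le (k := s + 1) (n := n) m (by omega)
    rw [← Finset.compl_filter, ← hP] at h
    have h : (2 : ℝ) ^ n * Pᶜ.card ≤ 2 ^ (s + 1) * (2 ^ n) ^ (s + 1 + m) := by exact_mod_cast h
    rw [hsq, le_inv_mul_iff₀ (by positivity), eq_sub_of_add_eq hcardY]
    have := mul_le_mul_of_nonneg_right hpow (show (0 : ℝ) ≤ (2 ^ n) ^ (s + 1 + m) by positivity)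
    refine le_of_mul_le_mul_left ?_ hq
    rw [pow_succ 2 s] at h
    linarith
  have hP1 : (r ^ (s + 1 + m)) ^ 2 * (P.card : ℝ) ≤ 1 := by
    rw [hsq, inv_mul_le_iff₀ (by positivity), mul_one, ← hcardY]
    simp
  -- `#(Gram matrices on G) · #(largest fibre on P) / 2 ^ (n (s + 1 + m)) ≤ 2 ^ (s + 1) / 2 ^ n`.
  have hmain : (r ^ (s + 1 + m)) ^ 2 * (r ^ s) ^ 2 * ((G.image tupleGram).card : ℝ)
      * (orthogonalCard (s + 1) * (2 ^ n) ^ m : ℕ) * G.card ≤ 1 / 8 := by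
    have h1 : ((G.image tupleGram).card : ℝ) * orthogonalCard s ≤ (2 ^ n) ^ s := by
      have := card_image_gram_mul (k := s) (n := n)
      rw [← hG] at this
      exact_mod_cast this
    have h2 : (orthogonalCard (s + 1) : ℝ) ≤ orthogonalCard s * 2 ^ (s + 1) := by
      exact_mod_cast orthogonalCard_succ_le s
    have h3 : (G.card : ℝ) ≤ (2 ^ n) ^ s := by
      have : G.card ≤ (2 ^ n) ^ s := by
        refine (Finset.card_le_univ G).trans ?_
        simp
      exact_mod_cast this
    rw [hsq, hsq]
    push_cast
    have h4 : ((G.image tupleGram).card : ℝ) * orthogonalCard (s + 1)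
        ≤ (2 ^ n) ^ s * 2 ^ (s + 1) :=
      calc _ ≤ ((G.image tupleGram).card : ℝ) * (orthogonalCard s * 2 ^ (s + 1)) :=
            mul_le_mul_of_nonneg_left h2 (by positivity)
        _ = ((G.image tupleGram).card * orthogonalCard s : ℝ) * 2 ^ (s + 1) := by ring
        _ ≤ _ := mul_le_mul_of_nonneg_right h1 (by positivity)
    have h5 := mul_le_mul h4 h3 (by positivity) (by positivity)
    have h6 : (((2 : ℝ) ^ n) ^ (s + 1 + m))⁻¹ * ((2 ^ n) ^ s)⁻¹ * (2 ^ n) ^ m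
        = ((2 ^ n) ^ s)⁻¹ * ((2 ^ n) ^ s)⁻¹ * (2 ^ n)⁻¹ := by
      field_simp
      ring
    calc _ = ((((2 : ℝ) ^ n) ^ (s + 1 + m))⁻¹ * ((2 ^ n) ^ s)⁻¹ * (2 ^ n) ^ m)
          * (((G.image tupleGram).card : ℝ) * orthogonalCard (s + 1) * G.card) := by ring
      _ ≤ ((((2 : ℝ) ^ n) ^ (s + 1 + m))⁻¹ * ((2 ^ n) ^ s)⁻¹ * (2 ^ n) ^ m)
          * ((2 ^ n) ^ s * 2 ^ (s + 1) * (2 ^ n) ^ s) :=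
          mul_le_mul_of_nonneg_left h5 (by positivity)
      _ = (2 ^ n)⁻¹ * 2 ^ (s + 1) := by
          rw [h6]
          field_simp
      _ ≤ 1 / 8 := by
          rw [inv_mul_le_iff₀ hq, pow_succ]
          linarith
  have hupper := sum_expectation_map_le hpos htr
    tupleGram tupleGram G P (orthogonalCard (s + 1) * (2 ^ n) ^ m)
    (fun σ => by
      rw [hP, Finset.filter_filter]
      exact card_gram_fiber_add_le σ) (r ^ s) (r ^ (s + 1 + m)) hP1
  have hlower : ∀ A, 49 / 64 - 0.28 ≤ expectation
      (fun y => if y ∈ P then r ^ (s + 1 + m) * sgn (pairing A (tupleGram y)) else 0)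
      (Λ (realKetBra fun x => r ^ s * sgn (pairing A (tupleGram x)))) := fun A => by
    have h1 := hΛ _ (ketBra_phaseState_mem_stab A)
    rw [copies_ketBra_phaseState, copies_ketBra_phaseState, traceDist] at h1
    set g : (Fin (s + 1 + m) → Qubits n) → ℝ :=
      fun y => if y ∈ P then phasePower (s + 1 + m) A y else 0 with hg
    have hover : ∑ y, g y * phasePower (s + 1 + m) A y = (r ^ (s + 1 + m)) ^ 2 * (P.card : ℝ) := by
      simp only [hg, ite_mul, zero_mul, ← sq, phasePower_sq, Finset.sum_ite_mem, Finset.univ_inter,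
        Finset.sum_const, nsmul_eq_mul, hsq]
      ring
    have hnorm : ∑ y, g y ^ 2 ≤ 1 := by
      refine le_trans (le_of_eq ?_) hP1
      rw [← hover]
      refine Finset.sum_congr rfl fun y _ => ?_
      by_cases hy : y ∈ P <;> simp [hg, hy, sq]
    have hherm : (Λ (realKetBra (phasePower s A))
        - realKetBra (phasePower (s + 1 + m) A)).IsHermitian :=
      (hpos _ (posSemidef_realKetBra _)).isHermitian.sub
        (posSemidef_realKetBra _).isHermitian
    -- The trace norm is twice the trace distance, hence the loss `0.28 = 2 * 0.14`.
    have h2 := neg_traceNorm_le_expectation hnorm hherm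
    rw [expectation_sub, expectation_realKetBra, hover] at h2
    have h3 : (7 / 8 : ℝ) ^ 2 ≤ ((r ^ (s + 1 + m)) ^ 2 * (P.card : ℝ)) ^ 2 :=
      pow_le_pow_left₀ (by norm_num) hPc 2
    change _ ≤ expectation g (Λ (realKetBra (phasePower s A)))
    norm_num at h3 hε ⊢
    linarith
  have hsum := Finset.sum_le_sum fun A (_ : A ∈ Finset.univ) => hlower A
  rw [Finset.sum_const, Finset.card_univ, nsmul_eq_mul] at hsum
  have hcard : (0 : ℝ) < Fintype.card (Matrix (Fin n) (Fin n) (ZMod 2)) :=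
    Nat.cast_pos.2 Fintype.card_pos
  have hfin := le_of_mul_le_mul_left (hsum.trans hupper) hcard
  have hnum : (49 / 64 - 0.28 : ℝ) ≤ 2 * (1 / 8) + 2 * (1 / 16) :=
    hfin.trans (add_le_add (mul_le_mul_of_nonneg_left hmain zero_le_two)
      (mul_le_mul_of_nonneg_left hGc zero_le_two))
  norm_num at hnum

theorem theorem4 (n : ℕ) (ε : ℝ) (hε : ε ≤ 0.14) :
    (∀ t : ℕ, 1 ≤ t → t ≤ n / 4 → ¬ AdmitsCloning (Stab n) (t - 1) t ε) ∧
      (∀ s m : ℕ, 1 ≤ m → AdmitsCloning (Stab n) s (s + m) ε → n / 4 ≤ s) := by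
  constructor
  · intro t ht htn
    obtain ⟨s, rfl⟩ := Nat.exists_eq_add_of_le' ht
    exact not_admitsCloning_stab (m := 0) hε (by omega)
  · intro s m hm h
    by_contra hs
    obtain ⟨k, rfl⟩ := Nat.exists_eq_add_of_le hm
    rw [← add_assoc] at h
    exact not_admitsCloning_stab hε (by omega) h
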